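/- Let $I=\{1,\dots,s+1\}$ with $s\ge 1$, and let $f_i:\mathbb R\to\mathbb R$ ($i\in I$) be $\mathcal C^{1+\epsilon}$ diffeomorphisms for some $\epsilon>0$ (that is, $\mathcal C^1$ diffeomorphisms whose derivatives are $\epsilon$-Hölder continuous on compact sets). Let $\overline{\mathbb R}=\mathbb R\cup\{\pm\infty\}$ be the two-point compactification of $\mathbb R$, with a metric $d$ that generates its topology and that is strongly equivalent to the Euclidean metric on compact subsets of $\mathbb R$: for each compact $K\subset\mathbb R$ there is $C>0$ with $C^{-1}|x-y|\le d(x,y)\le C|x-y|$ for all $x,y\in K$. Extend each $f_i$ to $\overline{\mathbb R}$ by $f_i(\pm\infty)=\pm\infty$. Assume that $(f_i)_{i\in I}$ * is expanding: there is $\lambda>1$ with $f_i'(x)\ge\lambda$ for all $x\in\mathbb R$, $i\in I$; * has no common fixed point: there is no $x\in\mathbb R$ with $f_i(x)=x$ for all $i\in I$; * is contracting near infinity: there are neighbourhoods $V^{+}$ of $+\infty$ and $V^{-}$ of $-\infty$ in $\overline{\mathbb R}$ such that, for every $i\in I$, the restrictions of $f_i$ to $V^+$ and to $V^-$ have Lipschitz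 constant $<1$ with respect to $d$; * satisfies the open set condition: there is a non-empty bounded open interval $O\subset\mathbb R$ with $f_i^{-1}(O)\subset O$ for all $i\in I$ and $f_i^{-1}(O)\cap f_j^{-1}(O)=\emptyset$ for all $i\ne j$. Let $\vec p=(p_1,\dots,p_s)\in(0,1)^s$ with $\sum_{i=1}^s p_i<1$, and $p_{s+1}=1-\sum_{i=1}^s p_i$. The transition operator is $M_{\vec p}h=\sum_{i\in I}p_i\,(h\circ f_i)$ for $h:\overline{\mathbb R}\to\mathbb R$. For $\alpha>0$ let $\mathcal C^\alpha$ be the space of functions $h:\overline{\mathbb R}\to\mathbb R$ with $V_\alpha(h)=\sup_{x\ne y}|h(x)-h(y)|/d(x,y)^\alpha<\infty$, with the norm $\|h\|_\alpha=V_\alpha(h)+\sup|h|$. Let $\Sigma=I^{\mathbb N}$ and let $\sigma$ be the shift on $\Sigma$. For $\omega\in\Sigma$ let $\pi(\omega)$ be the unique point $x\in\mathbb R$ whose orbit $(f_{\omega_n}\circ\dots\circ f_{\omega_1}(x))_{n\ge 1}$ is bounded in $\mathbb R$ (that is, stays outside a neighbourhood of $\{\pm\infty\}$). Put $\varphi(\omega)=-\log|f_{\omega_1}'(\pi(\omega))|$,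 $\psi(\omega)=\log p_{\omega_1}$, $S_nu=\sum_{k=0}^{n-1}u\circ\sigma^k$, and $$\alpha_-=\inf_{\omega\in\Sigma}\liminf_{n\to\infty}\frac{S_n\psi(\omega)}{S_n\varphi(\omega)}.$$ Suppose that $\alpha_-<1$. Then for each $\alpha$ with $\alpha_-<\alpha<1$ every iterate $M_{\vec p}^n$ is a bounded operator from $\mathcal C^\alpha$ to itself, and there is $\phi\in\mathcal C^\alpha$ with $\|M_{\vec p}^n\phi\|_\alpha\to\infty$ as $n\to\infty$. In particular, the operator norms of $M_{\vec p}^n$ on $\mathcal C^\alpha$ tend to infinity as $n\to\infty$. -/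

import Mathlib

open Filter Topology Set
open scoped ENNReal

noncomputable section

namespace RealRDS

/-! The two-point compactification of the real line is `EReal` with its order topology. -/

/-- Extension of a self-map of `ℝ` to `EReal` by `±∞ ↦ ±∞`. -/
def extend (f : ℝ → ℝ) : EReal → EReal
  | ⊥ => ⊥
  | ⊤ => ⊤
  | (x : ℝ) => (f x : EReal)

theorem extend_bot (f : ℝ → ℝ) : extend f ⊥ = ⊥ := rfl

theorem extend_top (f : ℝ → ℝ) : extend f ⊤ = ⊤ := rfl

theorem extend_coe (f : ℝ → ℝ) (x : ℝ) : extend f (x : EReal) = (f x : EReal) := rfl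

/-- `d` is a metric on `EReal` which generates the topology of the two-point compactification
and is strongly equivalent to the Euclidean metric on compact subsets of `ℝ`. -/
structure IsAdmissibleMetric (d : EReal → EReal → ℝ) : Prop where
  eq_zero_iff : ∀ x y, d x y = 0 ↔ x = y
  symm : ∀ x y, d x y = d y x
  triangle : ∀ x y z, d x z ≤ d x y + d y z
  isOpen_iff : ∀ U : Set EReal,
    IsOpen U ↔ ∀ x ∈ U, ∃ r : ℝ, 0 < r ∧ ∀ y, d x y < r → y ∈ U
  equiv_euclidean : ∀ K : Set ℝ, IsCompact K → ∃ C : ℝ, 0 < C ∧ ∀ x ∈ K, ∀ y ∈ K,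
    C⁻¹ * |x - y| ≤ d x y ∧ d x y ≤ C * |x - y|

variable {s : ℕ}

/-- A family of `C^{1+ε}` diffeomorphisms of the real line, for some `ε > 0`: continuously
differentiable bijections whose derivatives are `ε`-Hölder continuous on compact sets.
(That derivatives do not vanish is part of the expansion property below.) -/
def IsC1HolderFamily (f : Fin (s + 1) → ℝ → ℝ) : Prop :=
  (∀ i, Function.Bijective (f i) ∧ ContDiff ℝ 1 (f i)) ∧
  ∃ ε : ℝ, 0 < ε ∧ ∀ i, ∀ K : Set ℝ, IsCompact K → ∃ C : ℝ, ∀ x ∈ K, ∀ y ∈ K,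
    |deriv (f i) x - deriv (f i) y| ≤ C * |x - y| ^ ε

/-- The family is expanding. -/
def IsExpanding (f : Fin (s + 1) → ℝ → ℝ) : Prop :=
  ∃ l : ℝ, 1 < l ∧ ∀ i x, l ≤ deriv (f i) x

/-- The maps have no common fixed point in `ℝ`. -/
def HasNoCommonFixedPoint (f : Fin (s + 1) → ℝ → ℝ) : Prop :=
  ¬ ∃ x : ℝ, ∀ i, f i x = x

/-- The family is contracting near infinity with respect to `d`: on suitable neighbourhoods
of `+∞` and of `-∞` the Lipschitz constants of the maps are less than one. -/
def IsContractingNearInfinity (d : EReal → EReal → ℝ) (f : Fin (s + 1) → ℝ → ℝ) : Prop :=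
  ∃ Vp ∈ 𝓝 (⊤ : EReal), ∃ Vm ∈ 𝓝 (⊥ : EReal), ∀ i,
    (∃ c : ℝ, c < 1 ∧ ∀ x ∈ Vp, ∀ y ∈ Vp, d (extend (f i) x) (extend (f i) y) ≤ c * d x y) ∧
    (∃ c : ℝ, c < 1 ∧ ∀ x ∈ Vm, ∀ y ∈ Vm, d (extend (f i) x) (extend (f i) y) ≤ c * d x y)

/-- The open set condition, for some non-empty bounded open interval `(a, b)`. -/
def OpenSetCondition (f : Fin (s + 1) → ℝ → ℝ) : Prop :=
  ∃ a b : ℝ, a < b ∧ (∀ i, f i ⁻¹' Ioo a b ⊆ Ioo a b) ∧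
    ∀ i j, i ≠ j → Disjoint (f i ⁻¹' Ioo a b) (f j ⁻¹' Ioo a b)

/-- The point `f_{ω_n} ∘ ⋯ ∘ f_{ω_1} (x)`. Sequences are indexed from zero, so that `ω 0`
is the first symbol. -/
def orbit (f : Fin (s + 1) → ℝ → ℝ) (ω : ℕ → Fin (s + 1)) : ℕ → ℝ → ℝ
  | 0, x => x
  | n + 1, x => f (ω n) (orbit f ω n x)

/-- The orbit of `x` along `ω` stays outside some neighbourhood of `{-∞, +∞}`. -/
def HasBoundedOrbit (f : Fin (s + 1) → ℝ → ℝ) (ω : ℕ → Fin (s + 1)) (x : ℝ) : Prop :=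
  ∃ R : ℝ, ∀ n, |orbit f ω n x| ≤ R

/-- The coding map `π`: the point of `ℝ` whose orbit along `ω` does not escape to `±∞`.
It exists and is unique for expanding families, see `existsUnique_hasBoundedOrbit`. -/
def coding (f : Fin (s + 1) → ℝ → ℝ) (ω : ℕ → Fin (s + 1)) : ℝ :=
  Classical.epsilon (HasBoundedOrbit f ω)

theorem expanding_abs {g : ℝ → ℝ} {l : ℝ} (hl : 1 < l) (hg : ∀ x, l ≤ deriv g x) (x y : ℝ) :
    l * |x - y| ≤ |g x - g y| := by
  have hd : Differentiable ℝ g := fun x => by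
    by_contra h
    have := hg x
    rw [deriv_zero_of_not_differentiableAt h] at this
    linarith
  have key : ∀ x y : ℝ, x ≤ y → l * (y - x) ≤ g y - g x := fun x y hxy =>
    mul_sub_le_image_sub_of_le_deriv hd hg hxy
  rcases le_total x y with h | h
  · have := key x y h
    rw [abs_sub_comm, abs_sub_comm (g x), abs_of_nonneg (sub_nonneg.2 h)]
    exact this.trans (le_abs_self _)
  · have := key y x h
    rw [abs_of_nonneg (sub_nonneg.2 h)]
    exact this.trans (le_abs_self _)

theorem existsUnique_hasBoundedOrbit {f : Fin (s + 1) → ℝ → ℝ} (hf : IsC1HolderFamily f)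
    (he : IsExpanding f) (ω : ℕ → Fin (s + 1)) : ∃! x, HasBoundedOrbit f ω x := by
  obtain ⟨l, hl, hl'⟩ := he
  have hab := fun i x y => expanding_abs hl (hl' i) x y
  have hl0 : 0 < l - 1 := by linarith
  set R : ℝ := ∑ i, |f i 0| / (l - 1) with hR
  have hRi : ∀ i, |f i 0| ≤ (l - 1) * R := fun i => by
    have h1 : |f i 0| / (l - 1) ≤ R :=
      Finset.single_le_sum (f := fun i => |f i 0| / (l - 1))
        (fun j _ => div_nonneg (abs_nonneg _) hl0.le) (Finset.mem_univ i)
    rw [div_le_iff₀ hl0] at h1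
    linarith
  have hR0 : 0 ≤ R := Finset.sum_nonneg fun j _ => div_nonneg (abs_nonneg _) hl0.le
  have hin : ∀ i x, |f i x| ≤ R → |x| ≤ R := fun i x h => by
    by_contra! hx
    have h1 := hab i x 0
    rw [sub_zero] at h1
    have h2 := abs_sub (f i x) (f i 0)
    have h3 := hRi i
    nlinarith
  have hcont : ∀ n, Continuous (orbit f ω n) := fun n => by
    induction n with
    | zero => exact continuous_id
    | succ n ih => exact (hf.1 (ω n)).2.continuous.comp ih
  have hsurj : ∀ n, Function.Surjective (orbit f ω n) := fun n => by
    induction n with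
    | zero => exact Function.surjective_id
    | succ n ih => exact (hf.1 (ω n)).1.surjective.comp ih
  have hclosed : ∀ n, IsClosed {x | |orbit f ω n x| ≤ R} := fun n =>
    isClosed_le (hcont n).abs continuous_const
  obtain ⟨x, hx⟩ := IsCompact.nonempty_iInter_of_sequence_nonempty_isCompact_isClosed
    (fun n => {x | |orbit f ω n x| ≤ R}) (fun n x h => hin (ω n) _ h)
    (fun n => by
      obtain ⟨x, hx⟩ := hsurj n 0
      exact ⟨x, by simpa [hx] using hR0⟩)
    ((isCompact_Icc (a := -R) (b := R)).of_isClosed_subset (hclosed 0)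
      fun x h => abs_le.1 h) hclosed
  refine ⟨x, ⟨R, fun n => mem_iInter.1 hx n⟩, ?_⟩
  rintro y ⟨R', hy⟩
  have hgrow : ∀ n, l ^ n * |y - x| ≤ |orbit f ω n y - orbit f ω n x| := fun n => by
    induction n with
    | zero => simp [orbit]
    | succ n ih =>
      calc l ^ (n + 1) * |y - x| = l * (l ^ n * |y - x|) := by ring
        _ ≤ l * |orbit f ω n y - orbit f ω n x| := by gcongr
        _ ≤ _ := hab (ω n) _ _
  by_contra hne
  have hpos : 0 < |y - x| := abs_pos.2 (sub_ne_zero.2 hne)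
  obtain ⟨n, hn⟩ := pow_unbounded_of_one_lt ((R' + R) / |y - x|) hl
  rw [div_lt_iff₀ hpos] at hn
  have h1 := hgrow n
  have h2 := abs_sub (orbit f ω n y) (orbit f ω n x)
  have h3 := hy n
  have h4 : |orbit f ω n x| ≤ R := mem_iInter.1 hx n
  linarith

/-- The shift map on sequences of symbols. -/
def shift (ω : ℕ → Fin (s + 1)) : ℕ → Fin (s + 1) := fun k => ω (k + 1)

/-- The geometric potential `φ(ω) = -log |f'_{ω_1}(π(ω))|`. -/
def phi (f : Fin (s + 1) → ℝ → ℝ) (ω : ℕ → Fin (s + 1)) : ℝ :=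
  -Real.log |deriv (f (ω 0)) (coding f ω)|

/-- The potential `ψ(ω) = log p_{ω_1}`. -/
def psi (p : Fin (s + 1) → ℝ) (ω : ℕ → Fin (s + 1)) : ℝ := Real.log (p (ω 0))

/-- The bottom of the spectrum
`α₋ = inf_ω liminf_n S_n ψ (ω) / S_n φ (ω)`, as an extended real number. -/
def alphaMinus (f : Fin (s + 1) → ℝ → ℝ) (p : Fin (s + 1) → ℝ) : EReal :=
  ⨅ ω : ℕ → Fin (s + 1), liminf (fun n : ℕ =>
    ((birkhoffSum shift (psi p) n ω / birkhoffSum shift (phi f) n ω : ℝ) : EReal)) atTop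

/-- The transition operator `M_p h = ∑ i, p_i • (h ∘ f_i)`. -/
def transition (f : Fin (s + 1) → ℝ → ℝ) (p : Fin (s + 1) → ℝ) (h : EReal → ℝ) : EReal → ℝ :=
  fun x => ∑ i, p i * h (extend (f i) x)

/-- The Hölder constant `V_α(h) = sup_{x ≠ y} |h x - h y| / d(x, y)^α`, in `[0, ∞]`. -/
def holderConst (d : EReal → EReal → ℝ) (α : ℝ) (h : EReal → ℝ) : ℝ≥0∞ :=
  ⨆ (x : EReal) (y : EReal) (_ : x ≠ y), ENNReal.ofReal (|h x - h y| / d x y ^ α)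

/-- `h` is `α`-Hölder continuous, that is, a member of `C^α`. -/
def IsHolder (d : EReal → EReal → ℝ) (α : ℝ) (h : EReal → ℝ) : Prop :=
  holderConst d α h < ⊤

/-- The Hölder norm `‖h‖_α = V_α(h) + ‖h‖_∞`, in `[0, ∞]`. -/
def holderNorm (d : EReal → EReal → ℝ) (α : ℝ) (h : EReal → ℝ) : ℝ≥0∞ :=
  holderConst d α h + ⨆ x : EReal, ENNReal.ofReal |h x|

/-- The operator norm on `C^α`, in `[0, ∞]`: the supremum of `‖A h‖_α` over the closed unit
ball of `C^α`. -/
def holderOpNorm (d : EReal → EReal → ℝ) (α : ℝ) (A : (EReal → ℝ) → (EReal → ℝ)) : ℝ≥0∞ :=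
  ⨆ (h : EReal → ℝ) (_ : IsHolder d α h) (_ : holderNorm d α h ≤ 1), holderNorm d α (A h)

end RealRDS

end

/-!
Boundedness of the iterates of `M = transition f p` only needs that each extended map is Lipschitz
for `d`: this holds near `±∞` by contraction and on compact intervals because `f i` is `C¹`, and
local Lipschitz bounds become global by compactness (`IsAdmissibleMetric.exists_lipschitz_of_local`).

For the growth, let `(a, b)` be the interval of the open set condition. The maps are increasing and
move `a` to the left and `b` to the right. Let `h` be `0` to the left of `a`, `c > 0` to the right
of `b` and affine in between; all iterates `M^k h` keep the values `0` and `c` there. Given a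
symbol sequence `ω`, let `[z, y]` be the cylinder interval which the composition `F` along the
first `m` symbols of `ω` maps onto `[a, b]`. Under every other word of length `m` the two endpoints
go to the same side of `(a, b)`, where the iterates of `h` are constant. Hence, for *every*
`n ≥ m`,
`(M^n h) y - (M^n h) z = c * p_{ω_1} ⋯ p_{ω_m}` (`transition_iterate_sub`).
The interval contains the point coded by `ω`, so bounded distortion bounds its length by a multiple
of `exp (S_m φ ω)`, with `φ` the geometric potential
(`exists_sub_le_exp_birkhoffSum_phi`). Thus the Hölder constant of `M^n h` is at least a multiple of
`exp (S_m ψ ω - α * S_m φ ω)` whenever `n ≥ m` (`exists_le_holderConst_iterate`). Since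
`alphaMinus f p < α`, some `ω` satisfies `S_m ψ ω ≥ α' * S_m φ ω` with a fixed `α' < α` for
infinitely many `m`, and expansion gives `-S_m φ ω ≥ m * log l`, so that these lower bounds are
unbounded.
-/

open Filter Topology Set
open scoped ENNReal

namespace RealRDS

/-! ### Admissible metrics on the two-point compactification -/

namespace IsAdmissibleMetric

variable {d : EReal → EReal → ℝ}

theorem nonneg (hd : IsAdmissibleMetric d) (x y : EReal) : 0 ≤ d x y := by
  have h1 := hd.triangle x y x
  rw [(hd.eq_zero_iff x x).2 rfl, hd.symm y x] at h1
  linarith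

theorem pos (hd : IsAdmissibleMetric d) {x y : EReal} (h : x ≠ y) : 0 < d x y :=
  (hd.nonneg x y).lt_of_ne fun h0 => h ((hd.eq_zero_iff x y).1 h0.symm)

theorem exists_ball_subset (hd : IsAdmissibleMetric d) {x : EReal} {V : Set EReal}
    (hV : V ∈ 𝓝 x) : ∃ r : ℝ, 0 < r ∧ ∀ y, d x y < r → y ∈ V := by
  obtain ⟨U, hUV, hU, hx⟩ := mem_nhds_iff.1 hV
  obtain ⟨r, hr, h⟩ := (hd.isOpen_iff U).1 hU x hx
  exact ⟨r, hr, fun y hy => hUV (h y hy)⟩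

theorem ball_mem_nhds (hd : IsAdmissibleMetric d) (x : EReal) {r : ℝ} (hr : 0 < r) :
    {y | d x y < r} ∈ 𝓝 x := by
  refine IsOpen.mem_nhds ((hd.isOpen_iff _).2 fun y hy => ?_) ?_
  · have hy' : d x y < r := hy
    refine ⟨r - d x y, by linarith, fun z hz => ?_⟩
    have := hd.triangle x y z
    change d x z < r
    linarith
  · simpa [(hd.eq_zero_iff x x).2 rfl] using hr

/-- Away from `±∞`, in the sense of `d`, there are only real numbers from a compact interval. -/
theorem exists_abs_le (hd : IsAdmissibleMetric d) {r : ℝ} (hr : 0 < r) :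
    ∃ R : ℝ, ∀ x : EReal, r ≤ d ⊤ x → r ≤ d ⊥ x → ∃ t : ℝ, x = t ∧ |t| ≤ R := by
  obtain ⟨u, hu⟩ := EReal.mem_nhds_top_iff.1 (hd.ball_mem_nhds ⊤ hr)
  obtain ⟨v, hv⟩ := EReal.mem_nhds_bot_iff.1 (hd.ball_mem_nhds ⊥ hr)
  refine ⟨max |u| |v|, fun x hx1 hx2 => ?_⟩
  have h1 : x ≤ u := not_lt.1 fun h => absurd (hu h) (not_lt.2 hx1)
  have h2 : (v : EReal) ≤ x := not_lt.1 fun h => absurd (hv h) (not_lt.2 hx2)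
  induction x with
  | bot => exact absurd h2 (by simp)
  | top => exact absurd h1 (by simp)
  | coe t =>
    have h1' : t ≤ u := by exact_mod_cast h1
    have h2' : v ≤ t := by exact_mod_cast h2
    refine ⟨t, rfl, abs_le.2 ⟨?_, ?_⟩⟩
    · linarith [neg_abs_le v, le_max_right |u| |v|]
    · linarith [le_abs_self u, le_max_left |u| |v|]

theorem exists_bounds (hd : IsAdmissibleMetric d) (R : ℝ) :
    ∃ C : ℝ, 0 < C ∧ ∀ x y : ℝ, |x| ≤ R → |y| ≤ R →
      |x - y| ≤ C * d x y ∧ d x y ≤ C * |x - y| := by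
  obtain ⟨C, hC, h⟩ := hd.equiv_euclidean (Icc (-R) R) isCompact_Icc
  refine ⟨C, hC, fun x y hx hy => ?_⟩
  have := h x (abs_le.1 hx) y (abs_le.1 hy)
  exact ⟨(inv_mul_le_iff₀ hC).1 this.1, this.2⟩

theorem exists_bound (hd : IsAdmissibleMetric d) : ∃ D : ℝ, 0 < D ∧ ∀ x y, d x y ≤ D := by
  obtain ⟨R, hR⟩ := hd.exists_abs_le one_pos
  obtain ⟨C, hC, h⟩ := hd.exists_bounds |R|
  have hx : ∀ x : EReal, d x 0 ≤ 1 + d ⊤ 0 + d ⊥ 0 + C * |R| := fun x => by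
    have h0 := hd.nonneg ⊤ 0
    have h1 := hd.nonneg ⊥ 0
    have h2 : 0 ≤ C * |R| := by positivity
    rcases lt_or_ge (d ⊤ x) 1 with h3 | h3
    · have := hd.triangle x ⊤ 0
      rw [hd.symm x ⊤] at this
      linarith
    rcases lt_or_ge (d ⊥ x) 1 with h4 | h4
    · have := hd.triangle x ⊥ 0
      rw [hd.symm x ⊥] at this
      linarith
    obtain ⟨t, rfl, ht⟩ := hR x h3 h4
    have h5 := (h t 0 (ht.trans (le_abs_self R)) (by simp)).2
    have h6 : C * |t - 0| ≤ C * |R| := by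
      rw [sub_zero]
      exact mul_le_mul_of_nonneg_left (ht.trans (le_abs_self R)) hC.le
    rw [EReal.coe_zero] at h5
    linarith
  have h0 := hd.nonneg 0 0
  refine ⟨2 * (1 + d ⊤ 0 + d ⊥ 0 + C * |R|), ?_, fun x y => ?_⟩
  · have := hd.nonneg ⊤ 0
    have := hd.nonneg ⊥ 0
    positivity
  · have := hd.triangle x 0 y
    rw [hd.symm 0 y] at this
    linarith [hx x, hx y]

/-- From local to global Lipschitz bounds, by compactness of `EReal`: a bounded function `q` of
two points, typically `q x y = d (F x) (F y)` or `q x y = |h x - h y|`, is bounded by a multiple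
of `d` if this holds near `+∞`, near `-∞` and on compact intervals of `ℝ`. -/
theorem exists_lipschitz_of_local (hd : IsAdmissibleMetric d) {q : EReal → EReal → ℝ} {B : ℝ}
    (hB : ∀ x y, q x y ≤ B) {Vp Vm : Set EReal} (hVp : Vp ∈ 𝓝 ⊤) (hVm : Vm ∈ 𝓝 ⊥) {cp cm : ℝ}
    (hp : ∀ x ∈ Vp, ∀ y ∈ Vp, q x y ≤ cp * d x y) (hm : ∀ x ∈ Vm, ∀ y ∈ Vm, q x y ≤ cm * d x y)
    (hK : ∀ R : ℝ, ∃ C : ℝ, ∀ x y : ℝ, |x| ≤ R → |y| ≤ R → q x y ≤ C * d x y) :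
    ∃ C : ℝ, 1 ≤ C ∧ ∀ x y, q x y ≤ C * d x y := by
  obtain ⟨r₁, hr₁, h₁⟩ := hd.exists_ball_subset hVp
  obtain ⟨r₂, hr₂, h₂⟩ := hd.exists_ball_subset hVm
  obtain ⟨r, hr, hrr₁, hrr₂⟩ : ∃ r : ℝ, 0 < r ∧ 2 * r ≤ r₁ ∧ 2 * r ≤ r₂ :=
    ⟨min r₁ r₂ / 2, by positivity, by linarith [min_le_left r₁ r₂],
      by linarith [min_le_right r₁ r₂]⟩
  obtain ⟨R, hR⟩ := hd.exists_abs_le (half_pos hr)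
  obtain ⟨C, hC⟩ := hK R
  set A : ℝ := 1 + |cp| + |cm| + |C| + |B| / (r / 2) with hA
  have hB0 : 0 ≤ |B| / (r / 2) := by positivity
  have hp0 := abs_nonneg cp
  have hm0 := abs_nonneg cm
  have hC0 := abs_nonneg C
  refine ⟨A, by linarith, fun x y => ?_⟩
  have hle : ∀ c, |c| ≤ A → q x y ≤ c * d x y → q x y ≤ A * d x y := fun c hc h =>
    h.trans (mul_le_mul_of_nonneg_right ((le_abs_self c).trans hc) (hd.nonneg x y))
  rcases lt_or_ge (d x y) (r / 2) with hxy | hxy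
  swap
  · refine hle (|B| / (r / 2)) (by rw [abs_of_nonneg hB0]; linarith) ?_
    calc q x y ≤ |B| := (hB x y).trans (le_abs_self B)
      _ = |B| / (r / 2) * (r / 2) := by field_simp
      _ ≤ _ := by gcongr
  rcases lt_or_ge (d ⊤ x) r with hx | hx
  · have := hd.triangle ⊤ x y
    exact hle cp (by linarith) (hp x (h₁ x (by linarith)) y (h₁ y (by linarith)))
  rcases lt_or_ge (d ⊥ x) r with hx' | hx'
  · have := hd.triangle ⊥ x y
    exact hle cm (by linarith) (hm x (h₂ x (by linarith)) y (h₂ y (by linarith)))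
  have hy := hd.triangle ⊤ y x
  have hy' := hd.triangle ⊥ y x
  rw [hd.symm y x] at hy hy'
  obtain ⟨t, rfl, ht⟩ := hR x (by linarith) (by linarith)
  obtain ⟨u, rfl, hu⟩ := hR y (by linarith) (by linarith)
  exact hle C (by linarith) (hC t u ht hu)

/-- The extension of a continuously differentiable map which is Lipschitz near `±∞` is globally
Lipschitz for `d`. -/
theorem exists_lipschitz_extend (hd : IsAdmissibleMetric d) {g : ℝ → ℝ} (hg : ContDiff ℝ 1 g)
    {Vp Vm : Set EReal} (hVp : Vp ∈ 𝓝 ⊤) (hVm : Vm ∈ 𝓝 ⊥) {cp cm : ℝ}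
    (hp : ∀ x ∈ Vp, ∀ y ∈ Vp, d (extend g x) (extend g y) ≤ cp * d x y)
    (hm : ∀ x ∈ Vm, ∀ y ∈ Vm, d (extend g x) (extend g y) ≤ cm * d x y) :
    ∃ C : ℝ, 1 ≤ C ∧ ∀ x y, d (extend g x) (extend g y) ≤ C * d x y := by
  obtain ⟨D, -, hD⟩ := hd.exists_bound
  refine hd.exists_lipschitz_of_local (fun x y => hD (extend g x) (extend g y)) hVp hVm hp hm
    fun R => ?_
  obtain ⟨R', hR'⟩ := (isCompact_Icc (a := -R) (b := R)).exists_bound_of_continuousOn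
    hg.continuous.continuousOn
  obtain ⟨L, hL⟩ := (isCompact_Icc (a := -R) (b := R)).exists_bound_of_continuousOn
    (hg.continuous_deriv le_rfl).continuousOn
  obtain ⟨C₁, hC₁, h₁⟩ := hd.exists_bounds R
  obtain ⟨C₂, hC₂, h₂⟩ := hd.exists_bounds R'
  refine ⟨C₂ * (|L| * C₁), fun x y hx hy => ?_⟩
  have hx' : x ∈ Icc (-R) R := abs_le.1 hx
  have hy' : y ∈ Icc (-R) R := abs_le.1 hy
  have hlip : |g x - g y| ≤ |L| * |x - y| := by
    simpa using (convex_Icc (-R) R).norm_image_sub_le_of_norm_deriv_le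
      (fun t _ => hg.differentiable one_ne_zero t)
      (fun t ht => (hL t ht).trans (le_abs_self L)) hy' hx'
  calc d (g x) (g y) ≤ C₂ * |g x - g y| := (h₂ _ _ (hR' x hx') (hR' y hy')).2
    _ ≤ C₂ * (|L| * |x - y|) := by gcongr
    _ ≤ C₂ * (|L| * (C₁ * d x y)) := by gcongr; exact (h₁ x y hx hy).1
    _ = _ := by ring

end IsAdmissibleMetric

/-! ### The Hölder norm -/

section Holder

variable {d : EReal → EReal → ℝ} {α : ℝ} {s : ℕ}

theorem holderConst_le (hd : IsAdmissibleMetric d) {h : EReal → ℝ} {C : ℝ}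
    (hC : ∀ x y, |h x - h y| ≤ C * d x y ^ α) : holderConst d α h ≤ ENNReal.ofReal C :=
  iSup_le fun x => iSup_le fun y => iSup_le fun hxy => ENNReal.ofReal_le_ofReal <|
    (div_le_iff₀ (Real.rpow_pos_of_pos (hd.pos hxy) α)).2 (hC x y)

theorem le_holderConst (d : EReal → EReal → ℝ) (α : ℝ) (h : EReal → ℝ) {x y : EReal}
    (hxy : x ≠ y) : ENNReal.ofReal (|h x - h y| / d x y ^ α) ≤ holderConst d α h :=
  le_iSup_of_le x <| le_iSup_of_le y <| le_iSup_of_le hxy le_rfl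

theorem IsHolder.abs_sub_le (hd : IsAdmissibleMetric d) (hα : 0 < α) {h : EReal → ℝ}
    (hh : IsHolder d α h) (x y : EReal) :
    |h x - h y| ≤ (holderConst d α h).toReal * d x y ^ α := by
  rcases eq_or_ne x y with rfl | hxy
  · simp [(hd.eq_zero_iff x x).2 rfl, Real.zero_rpow hα.ne']
  · rw [← div_le_iff₀ (Real.rpow_pos_of_pos (hd.pos hxy) α)]
    exact (ENNReal.ofReal_le_iff_le_toReal hh.ne).1 (le_holderConst d α h hxy)

/-- Since `EReal` has finite diameter, Lipschitz functions are Hölder of every exponent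
`α ≤ 1`. -/
theorem exists_holder_of_lipschitz (hd : IsAdmissibleMetric d) (hα1 : α ≤ 1)
    {h : EReal → ℝ} {C : ℝ} (hC0 : 0 ≤ C) (hC : ∀ x y, |h x - h y| ≤ C * d x y) :
    ∃ C' : ℝ, 0 ≤ C' ∧ ∀ x y, |h x - h y| ≤ C' * d x y ^ α := by
  obtain ⟨D, hD, hdD⟩ := hd.exists_bound
  refine ⟨C * D ^ (1 - α), by positivity, fun x y => ?_⟩
  rcases eq_or_ne x y with rfl | hxy
  · simpa using mul_nonneg (mul_nonneg hC0 (Real.rpow_nonneg hD.le _))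
      (Real.rpow_nonneg (hd.nonneg x x) _)
  · have h1 : d x y = d x y ^ (1 - α) * d x y ^ α := by
      rw [← Real.rpow_add (hd.pos hxy), sub_add_cancel, Real.rpow_one]
    calc |h x - h y| ≤ C * d x y := hC x y
      _ = C * (d x y ^ (1 - α) * d x y ^ α) := by rw [← h1]
      _ ≤ C * (D ^ (1 - α) * d x y ^ α) := by
        have := Real.rpow_le_rpow (hd.nonneg x y) (hdD x y) (sub_nonneg.2 hα1)
        have := Real.rpow_nonneg (hd.nonneg x y) α
        gcongr
      _ = _ := by ring

/-! ### Boundedness of the transition operator -/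

variable {f : Fin (s + 1) → ℝ → ℝ} {p : Fin (s + 1) → ℝ}

theorem exists_lipschitz_family (hd : IsAdmissibleMetric d) (hf : IsC1HolderFamily f)
    (hcon : IsContractingNearInfinity d f) :
    ∃ C : ℝ, 1 ≤ C ∧ ∀ i x y, d (extend (f i) x) (extend (f i) y) ≤ C * d x y := by
  obtain ⟨Vp, hVp, Vm, hVm, h⟩ := hcon
  have : ∀ i, ∃ C : ℝ, 1 ≤ C ∧ ∀ x y, d (extend (f i) x) (extend (f i) y) ≤ C * d x y :=
    fun i => by
      obtain ⟨⟨cp, -, hp⟩, cm, -, hm⟩ := h i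
      exact hd.exists_lipschitz_extend (hf.1 i).2 hVp hVm hp hm
  choose C hC1 hC using this
  have hCi : ∀ i, C i ≤ ∑ j, C j := fun i =>
    Finset.single_le_sum (fun j _ => zero_le_one.trans (hC1 j)) (Finset.mem_univ i)
  exact ⟨∑ j, C j, (hC1 0).trans (hCi 0), fun i x y =>
    (hC i x y).trans (mul_le_mul_of_nonneg_right (hCi i) (hd.nonneg x y))⟩

theorem holderConst_transition_le (hd : IsAdmissibleMetric d) (hα : 0 < α)
    (hp : ∀ i, 0 < p i) (hp1 : ∑ i, p i = 1) {C : ℝ} (hC1 : 1 ≤ C)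
    (hC : ∀ i x y, d (extend (f i) x) (extend (f i) y) ≤ C * d x y)
    {h : EReal → ℝ} (hh : IsHolder d α h) :
    holderConst d α (transition f p h) ≤ ENNReal.ofReal (C ^ α) * holderConst d α h := by
  have hC0 : 0 ≤ C := zero_le_one.trans hC1
  rw [← ENNReal.ofReal_toReal hh.ne, ← ENNReal.ofReal_mul (Real.rpow_nonneg hC0 α)]
  refine holderConst_le hd fun x y => ?_
  set V := (holderConst d α h).toReal with hV
  have hV0 : 0 ≤ V := ENNReal.toReal_nonneg
  calc |transition f p h x - transition f p h y|
      = |∑ i, p i * (h (extend (f i) x) - h (extend (f i) y))| := by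
        simp only [transition, mul_sub, Finset.sum_sub_distrib]
    _ ≤ ∑ i, |p i * (h (extend (f i) x) - h (extend (f i) y))| :=
        Finset.abs_sum_le_sum_abs _ _
    _ ≤ ∑ i, p i * (C ^ α * V * d x y ^ α) := by
        refine Finset.sum_le_sum fun i _ => ?_
        rw [abs_mul, abs_of_pos (hp i)]
        refine mul_le_mul_of_nonneg_left ?_ (hp i).le
        calc _ ≤ V * d (extend (f i) x) (extend (f i) y) ^ α := hh.abs_sub_le hd hα _ _
          _ ≤ V * (C * d x y) ^ α := by
            gcongr
            · exact hd.nonneg _ _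
            · exact hC i x y
          _ = _ := by rw [Real.mul_rpow hC0 (hd.nonneg x y)]; ring
    _ = _ := by rw [← Finset.sum_mul, hp1, one_mul]

theorem iSup_abs_transition_le (hp : ∀ i, 0 < p i) (hp1 : ∑ i, p i = 1) (h : EReal → ℝ) :
    ⨆ x, ENNReal.ofReal |transition f p h x| ≤ ⨆ x, ENNReal.ofReal |h x| := by
  refine iSup_le fun x => ?_
  calc ENNReal.ofReal |transition f p h x|
      ≤ ENNReal.ofReal (∑ i, p i * |h (extend (f i) x)|) := by
        refine ENNReal.ofReal_le_ofReal ((Finset.abs_sum_le_sum_abs _ _).trans_eq ?_)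
        exact Finset.sum_congr rfl fun i _ => by rw [abs_mul, abs_of_pos (hp i)]
    _ = ∑ i, ENNReal.ofReal (p i) * ENNReal.ofReal |h (extend (f i) x)| := by
        rw [ENNReal.ofReal_sum_of_nonneg fun i _ => mul_nonneg (hp i).le (abs_nonneg _)]
        exact Finset.sum_congr rfl fun i _ => ENNReal.ofReal_mul (hp i).le
    _ ≤ ∑ i, ENNReal.ofReal (p i) * ⨆ x, ENNReal.ofReal |h x| := by
        gcongr with i
        exact le_iSup (fun x => ENNReal.ofReal |h x|) _
    _ = _ := by
        rw [← Finset.sum_mul, ← ENNReal.ofReal_sum_of_nonneg fun i _ => (hp i).le, hp1,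
          ENNReal.ofReal_one, one_mul]

theorem holderNorm_transition_le (hd : IsAdmissibleMetric d) (hα : 0 < α)
    (hp : ∀ i, 0 < p i) (hp1 : ∑ i, p i = 1) {C : ℝ} (hC1 : 1 ≤ C)
    (hC : ∀ i x y, d (extend (f i) x) (extend (f i) y) ≤ C * d x y)
    {h : EReal → ℝ} (hh : IsHolder d α h) :
    holderNorm d α (transition f p h) ≤ ENNReal.ofReal (C ^ α) * holderNorm d α h := by
  rw [holderNorm, holderNorm, mul_add]
  refine add_le_add (holderConst_transition_le hd hα hp hp1 hC1 hC hh) ?_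
  refine (iSup_abs_transition_le hp hp1 h).trans (le_mul_of_one_le_left' ?_)
  exact ENNReal.one_le_ofReal.2 (Real.one_le_rpow hC1 hα.le)

theorem isHolder_iterate_transition (hd : IsAdmissibleMetric d) (hf : IsC1HolderFamily f)
    (hcon : IsContractingNearInfinity d f) (hα : 0 < α) (hp : ∀ i, 0 < p i)
    (hp1 : ∑ i, p i = 1) (n : ℕ) {h : EReal → ℝ} (hh : IsHolder d α h) :
    IsHolder d α ((transition f p)^[n] h) := by
  obtain ⟨C, hC1, hC⟩ := exists_lipschitz_family hd hf hcon
  induction n with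
  | zero => exact hh
  | succ n ih =>
    rw [Function.iterate_succ_apply']
    exact (holderConst_transition_le hd hα hp hp1 hC1 hC ih).trans_lt
      (ENNReal.mul_lt_top ENNReal.ofReal_lt_top ih)

theorem holderOpNorm_iterate_transition_lt_top (hd : IsAdmissibleMetric d)
    (hf : IsC1HolderFamily f) (hcon : IsContractingNearInfinity d f) (hα : 0 < α)
    (hp : ∀ i, 0 < p i) (hp1 : ∑ i, p i = 1) (n : ℕ) :
    holderOpNorm d α ((transition f p)^[n]) < ⊤ := by
  obtain ⟨C, hC1, hC⟩ := exists_lipschitz_family hd hf hcon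
  have key : ∀ h : EReal → ℝ, IsHolder d α h →
      holderNorm d α ((transition f p)^[n] h) ≤ ENNReal.ofReal (C ^ α) ^ n * holderNorm d α h := by
    intro h hh
    induction n with
    | zero => simp
    | succ n ih =>
      rw [Function.iterate_succ_apply', pow_succ', mul_assoc]
      exact (holderNorm_transition_le hd hα hp hp1 hC1 hC
        (isHolder_iterate_transition hd hf hcon hα hp hp1 n hh)).trans (mul_le_mul_right ih _)
  refine lt_of_le_of_lt (iSup_le fun h => iSup_le fun hh => iSup_le fun h1 => ?_)
    (ENNReal.pow_lt_top (n := n) (ENNReal.ofReal_lt_top (r := C ^ α)))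
  exact (key h hh).trans (mul_le_of_le_one_right' h1)

end Holder

section Dynamics

variable {s : ℕ} {f : Fin (s + 1) → ℝ → ℝ} {p : Fin (s + 1) → ℝ}

/-! ### Orbits and the coding map -/

theorem orbit_succ_eq_orbit_shift (f : Fin (s + 1) → ℝ → ℝ) (ω : ℕ → Fin (s + 1)) (n : ℕ)
    (x : ℝ) : orbit f ω (n + 1) x = orbit f (shift ω) n (f (ω 0) x) := by
  induction n with
  | zero => rfl
  | succ n ih =>
    rw [orbit, ih]
    rfl

theorem orbit_surjective (hf : IsC1HolderFamily f) (ω : ℕ → Fin (s + 1)) (n : ℕ) :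
    Function.Surjective (orbit f ω n) := by
  induction n with
  | zero => exact Function.surjective_id
  | succ n ih => exact (hf.1 (ω n)).1.surjective.comp ih

variable {l : ℝ}

theorem strictMono_of_le_deriv (hl : 1 < l) (hexp : ∀ i x, l ≤ deriv (f i) x)
    (i : Fin (s + 1)) : StrictMono (f i) :=
  strictMono_of_deriv_pos fun x => by linarith [hexp i x]

theorem orbit_strictMono (hl : 1 < l) (hexp : ∀ i x, l ≤ deriv (f i) x)
    (ω : ℕ → Fin (s + 1)) (n : ℕ) : StrictMono (orbit f ω n) := by
  induction n with
  | zero => exact strictMono_id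
  | succ n ih => exact (strictMono_of_le_deriv hl hexp (ω n)).comp ih

theorem mul_sub_le_sub (hf : IsC1HolderFamily f) (hexp : ∀ i x, l ≤ deriv (f i) x)
    (i : Fin (s + 1)) {x y : ℝ} (hxy : x ≤ y) : l * (y - x) ≤ f i y - f i x :=
  mul_sub_le_image_sub_of_le_deriv ((hf.1 i).2.differentiable one_ne_zero) (hexp i) hxy

theorem pow_mul_sub_le_orbit_sub (hf : IsC1HolderFamily f) (hl : 1 < l)
    (hexp : ∀ i x, l ≤ deriv (f i) x) (ω : ℕ → Fin (s + 1)) (n : ℕ) {x y : ℝ} (hxy : x ≤ y) :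
    l ^ n * (y - x) ≤ orbit f ω n y - orbit f ω n x := by
  induction n with
  | zero => simp [orbit]
  | succ n ih =>
    calc l ^ (n + 1) * (y - x) = l * (l ^ n * (y - x)) := by ring
      _ ≤ l * (orbit f ω n y - orbit f ω n x) := by gcongr
      _ ≤ _ := mul_sub_le_sub hf hexp (ω n) ((orbit_strictMono hl hexp ω n).monotone hxy)

theorem hasBoundedOrbit_coding (hf : IsC1HolderFamily f) (he : IsExpanding f)
    (ω : ℕ → Fin (s + 1)) : HasBoundedOrbit f ω (coding f ω) :=
  Classical.epsilon_spec (existsUnique_hasBoundedOrbit hf he ω).exists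

theorem coding_shift (hf : IsC1HolderFamily f) (he : IsExpanding f) (ω : ℕ → Fin (s + 1)) :
    coding f (shift ω) = f (ω 0) (coding f ω) := by
  obtain ⟨R, hR⟩ := hasBoundedOrbit_coding hf he ω
  refine (existsUnique_hasBoundedOrbit hf he (shift ω)).unique
    (hasBoundedOrbit_coding hf he _) ⟨R, fun n => ?_⟩
  rw [← orbit_succ_eq_orbit_shift]
  exact hR (n + 1)

/-! ### Consequences of the open set condition -/

variable {a b : ℝ}

/-- An increasing bijection whose inverse maps `(a, b)` into itself moves the endpoints
outwards. -/
theorem le_left_and_right_le {g : ℝ → ℝ} (hab : a < b) (hg : StrictMono g)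
    (hs : Function.Surjective g) (h : g ⁻¹' Ioo a b ⊆ Ioo a b) : g a ≤ a ∧ b ≤ g b := by
  constructor
  · by_contra! hlt
    obtain ⟨c, hac, hc⟩ := exists_between (lt_min hlt hab)
    obtain ⟨t, rfl⟩ := hs c
    have h1 : t < a := hg.lt_iff_lt.1 (hc.trans_le (min_le_left _ _))
    exact absurd (h ⟨hac, hc.trans_le (min_le_right _ _)⟩).1 h1.not_gt
  · by_contra! hlt
    obtain ⟨c, hc, hcb⟩ := exists_between (max_lt hlt hab)
    obtain ⟨t, rfl⟩ := hs c
    have h1 : b < t := hg.lt_iff_lt.1 ((le_max_left _ _).trans_lt hc)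
    exact absurd (h ⟨(le_max_right _ _).trans_lt hc, hcb⟩).2 h1.not_gt

theorem orbit_left_le_and_le_orbit_right (hl : 1 < l) (hexp : ∀ i x, l ≤ deriv (f i) x)
    (hends : ∀ i, f i a ≤ a ∧ b ≤ f i b) (ω : ℕ → Fin (s + 1)) (n : ℕ) :
    orbit f ω n a ≤ a ∧ b ≤ orbit f ω n b := by
  induction n with
  | zero => exact ⟨le_rfl, le_rfl⟩
  | succ n ih =>
    have hm := (strictMono_of_le_deriv hl hexp (ω n)).monotone
    exact ⟨(hm ih.1).trans (hends _).1, (hends _).2.trans (hm ih.2)⟩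

theorem mem_Icc_of_orbit_mem_Icc (hl : 1 < l) (hexp : ∀ i x, l ≤ deriv (f i) x)
    (hends : ∀ i, f i a ≤ a ∧ b ≤ f i b) {ω : ℕ → Fin (s + 1)} {n : ℕ} {x : ℝ}
    (hx : orbit f ω n x ∈ Icc a b) : x ∈ Icc a b := by
  obtain ⟨ha, hb⟩ := orbit_left_le_and_le_orbit_right hl hexp hends ω n
  have hm := orbit_strictMono hl hexp ω n
  exact ⟨hm.le_iff_le.1 (ha.trans hx.1), hm.le_iff_le.1 (hx.2.trans hb)⟩

/-- Outside `[a, b]` orbits escape exponentially fast, so the coding map takes values in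
`[a, b]`. -/
theorem coding_mem_Icc (hf : IsC1HolderFamily f) (hl : 1 < l)
    (hexp : ∀ i x, l ≤ deriv (f i) x) (hends : ∀ i, f i a ≤ a ∧ b ≤ f i b)
    (ω : ℕ → Fin (s + 1)) : coding f ω ∈ Icc a b := by
  obtain ⟨R, hR⟩ := hasBoundedOrbit_coding hf ⟨l, hl, hexp⟩ ω
  set x := coding f ω
  constructor
  · by_contra! h
    obtain ⟨n, hn⟩ := pow_unbounded_of_one_lt ((a + R) / (a - x)) hl
    rw [div_lt_iff₀ (sub_pos.2 h)] at hn
    have h1 := pow_mul_sub_le_orbit_sub hf hl hexp ω n h.le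
    have h2 := (orbit_left_le_and_le_orbit_right hl hexp hends ω n).1
    linarith [(abs_le.1 (hR n)).1]
  · by_contra! h
    obtain ⟨n, hn⟩ := pow_unbounded_of_one_lt ((R - b) / (x - b)) hl
    rw [div_lt_iff₀ (sub_pos.2 h)] at hn
    have h1 := pow_mul_sub_le_orbit_sub hf hl hexp ω n h.le
    have h2 := (orbit_left_le_and_le_orbit_right hl hexp hends ω n).2
    linarith [(abs_le.1 (hR n)).2]

theorem orbit_coding_mem_Icc (hf : IsC1HolderFamily f) (hl : 1 < l)
    (hexp : ∀ i x, l ≤ deriv (f i) x) (hends : ∀ i, f i a ≤ a ∧ b ≤ f i b)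
    (ω : ℕ → Fin (s + 1)) (n : ℕ) : orbit f ω n (coding f ω) ∈ Icc a b := by
  induction n generalizing ω with
  | zero => exact coding_mem_Icc hf hl hexp hends ω
  | succ n ih =>
    rw [orbit_succ_eq_orbit_shift, ← coding_shift hf ⟨l, hl, hexp⟩]
    exact ih _

/-- If `f i` maps `[z, y]` into `[a, b]`, then all other maps `f j` move the two endpoints to
the same side of `(a, b)`. -/
theorem both_le_or_both_ge (hf : IsC1HolderFamily f) (hl : 1 < l)
    (hexp : ∀ i x, l ≤ deriv (f i) x) (hab : a < b) {i j : Fin (s + 1)}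
    (hdisj : Disjoint (f i ⁻¹' Ioo a b) (f j ⁻¹' Ioo a b)) {z y : ℝ} (hzy : z < y)
    (hz : a ≤ f i z) (hy : f i y ≤ b) :
    (f j z ≤ a ∧ f j y ≤ a) ∨ (b ≤ f j z ∧ b ≤ f j y) := by
  have hi := strictMono_of_le_deriv hl hexp i
  have hj := strictMono_of_le_deriv hl hexp j
  rcases le_or_gt (f j y) a with h1 | h1
  · exact Or.inl ⟨(hj hzy).le.trans h1, h1⟩
  rcases le_or_gt b (f j z) with h2 | h2
  · exact Or.inr ⟨h2, h2.trans (hj hzy).le⟩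
  obtain ⟨c, hc1, hc2⟩ := exists_between (max_lt (lt_min hab h1) (lt_min h2 (hj hzy)))
  obtain ⟨t, rfl⟩ := (hf.1 j).1.surjective c
  have hzt : z < t := hj.lt_iff_lt.1 ((le_max_right _ _).trans_lt hc1)
  have hty : t < y := hj.lt_iff_lt.1 (hc2.trans_le (min_le_right _ _))
  exact absurd ⟨(le_max_left _ _).trans_lt hc1, hc2.trans_le (min_le_left _ _)⟩
    (disjoint_left.1 hdisj ⟨hz.trans_lt (hi hzt), (hi hty).trans_le hy⟩)

theorem transition_iterate_succ_coe (f : Fin (s + 1) → ℝ → ℝ) (p : Fin (s + 1) → ℝ)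
    (h : EReal → ℝ) (n : ℕ) (x : ℝ) :
    (transition f p)^[n + 1] h x = ∑ i, p i * (transition f p)^[n] h (f i x : ℝ) := by
  rw [Function.iterate_succ_apply']
  rfl

/-- The transition operator preserves values on forward invariant sets where the function is
constant. -/
theorem transition_iterate_eq_of_invariant (hp1 : ∑ i, p i = 1) {h : EReal → ℝ} {S : Set ℝ}
    (hS : ∀ i, MapsTo (f i) S S) {u : ℝ} (hu : ∀ x ∈ S, h x = u) (n : ℕ) :
    ∀ x ∈ S, (transition f p)^[n] h x = u := by
  induction n with
  | zero => exact hu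
  | succ n ih =>
    intro x hx
    rw [transition_iterate_succ_coe, Finset.sum_congr rfl fun i _ => by rw [ih _ (hS i hx)],
      ← Finset.sum_mul, hp1, one_mul]

/-- The exact increment of the iterates of `h` over a cylinder interval. If `[z, y]` is mapped
onto `[a, b]` by the composition along the first `m` symbols of `ω`, then by the open set condition
this is the only one of the words of length `m` which contributes to the increment. -/
theorem transition_iterate_sub (hf : IsC1HolderFamily f) (hl : 1 < l)
    (hexp : ∀ i x, l ≤ deriv (f i) x) (hab : a < b)
    (hends : ∀ i, f i a ≤ a ∧ b ≤ f i b)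
    (hdisj : ∀ i j, i ≠ j → Disjoint (f i ⁻¹' Ioo a b) (f j ⁻¹' Ioo a b))
    (hp : ∀ i, 0 < p i) (hp1 : ∑ i, p i = 1) {h : EReal → ℝ} {u v : ℝ}
    (hu : ∀ x : ℝ, x ≤ a → h x = u) (hv : ∀ x : ℝ, b ≤ x → h x = v)
    {m n : ℕ} (hmn : m ≤ n) {ω : ℕ → Fin (s + 1)} {z y : ℝ}
    (hz : orbit f ω m z = a) (hy : orbit f ω m y = b) :
    (transition f p)^[n] h y - (transition f p)^[n] h z =
      Real.exp (birkhoffSum shift (psi p) m ω) * (v - u) := by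
  have hmono := strictMono_of_le_deriv hl hexp
  have hleft : ∀ n, ∀ x : ℝ, x ≤ a → (transition f p)^[n] h x = u := fun n =>
    transition_iterate_eq_of_invariant (S := Iic a) hp1
      (fun i x hx => ((hmono i).monotone hx).trans (hends i).1) hu n
  have hright : ∀ n, ∀ x : ℝ, b ≤ x → (transition f p)^[n] h x = v := fun n =>
    transition_iterate_eq_of_invariant (S := Ici b) hp1
      (fun i x hx => (hends i).2.trans ((hmono i).monotone hx)) hv n
  induction m generalizing n ω z y with
  | zero =>
    rw [orbit] at hz hy
    rw [hleft n z hz.le, hright n y hy.ge, birkhoffSum_zero, Real.exp_zero, one_mul]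
  | succ m ih =>
    obtain ⟨n, rfl⟩ : ∃ k, n = k + 1 := ⟨n - 1, by omega⟩
    have hzy : z < y := (orbit_strictMono hl hexp ω (m + 1)).lt_iff_lt.1 (by rwa [hz, hy])
    rw [orbit_succ_eq_orbit_shift] at hz hy
    have hz' : f (ω 0) z ∈ Icc a b :=
      mem_Icc_of_orbit_mem_Icc hl hexp hends (ω := shift ω) (n := m)
        (by rw [hz]; exact left_mem_Icc.2 hab.le)
    have hy' : f (ω 0) y ∈ Icc a b :=
      mem_Icc_of_orbit_mem_Icc hl hexp hends (ω := shift ω) (n := m)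
        (by rw [hy]; exact right_mem_Icc.2 hab.le)
    rw [transition_iterate_succ_coe, transition_iterate_succ_coe, ← Finset.sum_sub_distrib,
      Finset.sum_eq_single (ω 0), ← mul_sub, ih (by omega) hz hy, birkhoffSum_succ', Real.exp_add,
      psi, Real.exp_log (hp _), mul_assoc]
    · intro j _ hj
      rcases both_le_or_both_ge hf hl hexp hab (hdisj _ j hj.symm) hzy hz'.1 hy'.2 with h | h
      · rw [hleft n _ h.1, hleft n _ h.2, sub_self]
      · rw [hright n _ h.1, hright n _ h.2, sub_self]
    · exact fun h => absurd (Finset.mem_univ _) h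

/-! ### Bounded distortion -/

theorem exists_log_deriv_sub_le (hf : IsC1HolderFamily f) (hl : 1 < l)
    (hexp : ∀ i x, l ≤ deriv (f i) x) (a b : ℝ) :
    ∃ ε : ℝ, 0 < ε ∧ ∃ C : ℝ, 0 ≤ C ∧ ∀ i, ∀ x ∈ Icc a b, ∀ y ∈ Icc a b,
      Real.log (deriv (f i) x) - Real.log (deriv (f i) y) ≤ C * |x - y| ^ ε := by
  obtain ⟨ε, hε, h⟩ := hf.2
  choose C hC using fun i => h i (Icc a b) isCompact_Icc
  refine ⟨ε, hε, ∑ i, |C i|, Finset.sum_nonneg fun i _ => abs_nonneg _, fun i x hx y hy => ?_⟩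
  have hx1 : 0 < deriv (f i) x := by linarith [hexp i x]
  have hy1 : 1 ≤ deriv (f i) y := hl.le.trans (hexp i y)
  have hy0 : 0 < deriv (f i) y := by linarith
  calc Real.log (deriv (f i) x) - Real.log (deriv (f i) y)
      = Real.log (deriv (f i) x / deriv (f i) y) := (Real.log_div hx1.ne' hy0.ne').symm
    _ ≤ deriv (f i) x / deriv (f i) y - 1 := Real.log_le_sub_one_of_pos (by positivity)
    _ = (deriv (f i) x - deriv (f i) y) / deriv (f i) y := by field_simp
    _ ≤ |deriv (f i) x - deriv (f i) y| / deriv (f i) y := by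
        gcongr
        exact le_abs_self _
    _ ≤ |deriv (f i) x - deriv (f i) y| := div_le_self (abs_nonneg _) hy1
    _ ≤ C i * |x - y| ^ ε := hC i x hx y hy
    _ ≤ _ := by
        gcongr
        exact (le_abs_self _).trans
          (Finset.single_le_sum (fun j _ => abs_nonneg (C j)) (Finset.mem_univ i))

/-- Bounded distortion: the length of a cylinder interval of level `m` which contains the point
coded by `ω` is at most a constant times the inverse of the derivative at that point of the
composition along the first `m` symbols of `ω`. -/
theorem exists_sub_le_exp_birkhoffSum_phi (hf : IsC1HolderFamily f) (hl : 1 < l)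
    (hexp : ∀ i x, l ≤ deriv (f i) x) (hab : a < b) (hends : ∀ i, f i a ≤ a ∧ b ≤ f i b) :
    ∃ C : ℝ, 0 < C ∧ ∀ (m : ℕ) (ω : ℕ → Fin (s + 1)) (z y : ℝ),
      orbit f ω m z = a → orbit f ω m y = b →
        y - z ≤ C * Real.exp (birkhoffSum shift (phi f) m ω) := by
  obtain ⟨ε, hε, C, hC, hlog⟩ := exists_log_deriv_sub_le hf hl hexp a b
  have hl0 : 0 < l := by linarith
  set r : ℝ := (l ^ ε)⁻¹ with hr
  have hr1 : r < 1 := inv_lt_one_of_one_lt₀ (Real.one_lt_rpow hl hε)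
  have hr0 : 0 < r := by positivity
  set K : ℝ := C * (b - a) ^ ε with hK
  have hK0 : 0 ≤ K := mul_nonneg hC (Real.rpow_nonneg (by linarith) _)
  -- The cylinder interval of level `m` has length at most `(b - a) * l⁻ᵐ`, so the distortion of
  -- the first map is at most `K * r ^ m`; these bounds are summable over the levels.
  have key : ∀ (m : ℕ) (ω : ℕ → Fin (s + 1)) (z y : ℝ),
      orbit f ω m z = a → orbit f ω m y = b →
        y - z ≤ (b - a) * Real.exp (birkhoffSum shift (phi f) m ω +
          K * ∑ k ∈ Finset.range m, r ^ (k + 1)) := by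
    intro m
    induction m with
    | zero =>
      intro ω z y hz hy
      rw [orbit] at hz hy
      simp [hz, hy]
    | succ m ih =>
      intro ω z y hz hy
      have hmono := orbit_strictMono hl hexp ω (m + 1)
      have hzI : z ∈ Icc a b := mem_Icc_of_orbit_mem_Icc hl hexp hends (ω := ω) (n := m + 1)
        (by rw [hz]; exact left_mem_Icc.2 hab.le)
      have hyI : y ∈ Icc a b := mem_Icc_of_orbit_mem_Icc hl hexp hends (ω := ω) (n := m + 1)
        (by rw [hy]; exact right_mem_Icc.2 hab.le)
      have hzy : z < y := hmono.lt_iff_lt.1 (by rwa [hz, hy])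
      have hxI := coding_mem_Icc hf hl hexp hends ω
      have horb := orbit_coding_mem_Icc hf hl hexp hends ω (m + 1)
      have hzx : z ≤ coding f ω := hmono.le_iff_le.1 (hz.trans_le horb.1)
      have hxy : coding f ω ≤ y := hmono.le_iff_le.1 (horb.2.trans_eq hy.symm)
      have hsmall : (y - z) ^ ε ≤ (b - a) ^ ε * r ^ (m + 1) := by
        have h1 := pow_mul_sub_le_orbit_sub hf hl hexp ω (m + 1) hzy.le
        rw [hz, hy] at h1
        have h2 : y - z ≤ (b - a) * (l ^ (m + 1))⁻¹ := by
          rw [← div_eq_mul_inv, le_div_iff₀ (by positivity)]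
          linarith
        calc (y - z) ^ ε ≤ ((b - a) * (l ^ (m + 1))⁻¹) ^ ε :=
              Real.rpow_le_rpow (by linarith) h2 hε.le
          _ = (b - a) ^ ε * r ^ (m + 1) := by
              rw [Real.mul_rpow (by linarith) (by positivity), Real.inv_rpow (by positivity), hr,
                inv_pow, ← Real.rpow_natCast, ← Real.rpow_natCast, ← Real.rpow_mul hl0.le,
                ← Real.rpow_mul hl0.le, mul_comm ε]
      obtain ⟨ξ, hξ, hslope⟩ := exists_deriv_eq_slope (f (ω 0)) hzy
        (hf.1 (ω 0)).2.continuous.continuousOn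
        ((hf.1 (ω 0)).2.differentiable one_ne_zero).differentiableOn
      have hD : 0 < deriv (f (ω 0)) ξ := by linarith [hexp (ω 0) ξ]
      have hDx : 0 < deriv (f (ω 0)) (coding f ω) := by linarith [hexp (ω 0) (coding f ω)]
      have hyz : y - z = (f (ω 0) y - f (ω 0) z) * Real.exp (-Real.log (deriv (f (ω 0)) ξ)) := by
        have h0 : f (ω 0) y - f (ω 0) z ≠ 0 :=
          (sub_pos.2 (strictMono_of_le_deriv hl hexp (ω 0) hzy)).ne'
        rw [Real.exp_neg, Real.exp_log hD, hslope]
        field_simp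
      have hexpo : -Real.log (deriv (f (ω 0)) ξ) ≤ phi f ω + K * r ^ (m + 1) := by
        have h1 := hlog (ω 0) _ hxI ξ ⟨hzI.1.trans hξ.1.le, hξ.2.le.trans hyI.2⟩
        have h2 : |coding f ω - ξ| ≤ y - z :=
          abs_le.2 ⟨by linarith [hξ.2], by linarith [hξ.1]⟩
        have h3 : C * |coding f ω - ξ| ^ ε ≤ C * ((b - a) ^ ε * r ^ (m + 1)) := by
          gcongr
          exact (Real.rpow_le_rpow (abs_nonneg _) h2 hε.le).trans hsmall
        rw [phi, abs_of_pos hDx]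
        linarith
      rw [orbit_succ_eq_orbit_shift] at hz hy
      have hba : 0 < b - a := sub_pos.2 hab
      calc y - z = _ := hyz
        _ ≤ ((b - a) * Real.exp (birkhoffSum shift (phi f) m (shift ω) +
              K * ∑ k ∈ Finset.range m, r ^ (k + 1))) *
              Real.exp (phi f ω + K * r ^ (m + 1)) := by
            gcongr
            exact ih _ _ _ hz hy
        _ = _ := by
            rw [mul_assoc, ← Real.exp_add, birkhoffSum_succ', Finset.sum_range_succ]
            ring_nf
  have hsum : ∀ m, ∑ k ∈ Finset.range m, r ^ (k + 1) ≤ (1 - r)⁻¹ := fun m =>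
    calc ∑ k ∈ Finset.range m, r ^ (k + 1) ≤ ∑ k ∈ Finset.range m, r ^ k :=
          Finset.sum_le_sum fun k _ => pow_le_pow_of_le_one hr0.le hr1.le k.le_succ
      _ ≤ ∑' k, r ^ k := (summable_geometric_of_lt_one hr0.le hr1).sum_le_tsum _
          fun k _ => by positivity
      _ = _ := tsum_geometric_of_lt_one hr0.le hr1
  refine ⟨(b - a) * Real.exp (K * (1 - r)⁻¹), mul_pos (sub_pos.2 hab) (Real.exp_pos _),
    fun m ω z y hz hy => (key m ω z y hz hy).trans ?_⟩
  rw [mul_assoc (b - a), ← Real.exp_add, add_comm (K * (1 - r)⁻¹)]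
  have hba : 0 < b - a := sub_pos.2 hab
  gcongr
  exact hsum m

/-! ### The Birkhoff sums of the two potentials -/

theorem birkhoffSum_phi_le (hl : 1 < l) (hexp : ∀ i x, l ≤ deriv (f i) x) (m : ℕ)
    (ω : ℕ → Fin (s + 1)) : birkhoffSum shift (phi f) m ω ≤ -(m * Real.log l) := by
  induction m generalizing ω with
  | zero => simp
  | succ m ih =>
    have h1 : phi f ω ≤ -Real.log l := neg_le_neg <|
      Real.log_le_log (by linarith) ((hexp _ _).trans (le_abs_self _))
    rw [birkhoffSum_succ']
    push_cast
    linarith [ih (shift ω)]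

theorem birkhoffSum_psi_nonpos (hp : ∀ i, 0 < p i) (hp1 : ∑ i, p i = 1) (m : ℕ)
    (ω : ℕ → Fin (s + 1)) : birkhoffSum shift (psi p) m ω ≤ 0 :=
  Finset.sum_nonpos fun _ _ => Real.log_nonpos (hp _).le <| hp1 ▸
    Finset.single_le_sum (fun j _ => (hp j).le) (Finset.mem_univ _)

theorem birkhoffSum_div_nonneg (hl : 1 < l) (hexp : ∀ i x, l ≤ deriv (f i) x)
    (hp : ∀ i, 0 < p i) (hp1 : ∑ i, p i = 1) (m : ℕ) (ω : ℕ → Fin (s + 1)) :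
    0 ≤ birkhoffSum shift (psi p) m ω / birkhoffSum shift (phi f) m ω := by
  refine div_nonneg_of_nonpos (birkhoffSum_psi_nonpos hp hp1 m ω)
    ((birkhoffSum_phi_le hl hexp m ω).trans ?_)
  have := Real.log_nonneg hl.le
  rw [neg_nonpos]
  positivity

/-- Along a suitable `ω`, there are infinitely many `m` for which the probability of the first `m`
symbols is larger than a power `α' < α` of the inverse of the derivative. -/
theorem exists_frequently_birkhoffSum (hl : 1 < l) (hexp : ∀ i x, l ≤ deriv (f i) x)
    (hp : ∀ i, 0 < p i) (hp1 : ∑ i, p i = 1) {α : ℝ} (hα : alphaMinus f p < α) :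
    ∃ α' : ℝ, 0 < α' ∧ α' < α ∧ ∃ ω : ℕ → Fin (s + 1), ∃ᶠ m : ℕ in atTop,
      α' * birkhoffSum shift (phi f) m ω ≤ birkhoffSum shift (psi p) m ω := by
  obtain ⟨ω, hω⟩ := iInf_lt_iff.1 hα
  obtain ⟨α', h1, h2⟩ := EReal.lt_iff_exists_real_btwn.1 hω
  have hfr := (frequently_lt_of_liminf_lt (h := h1)).and_eventually (eventually_gt_atTop 0)
  have hneg : ∀ m : ℕ, 0 < m → birkhoffSum shift (phi f) m ω < 0 := fun m hm => by
    have : 0 < m * Real.log l := mul_pos (by exact_mod_cast hm) (Real.log_pos hl)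
    linarith [birkhoffSum_phi_le hl hexp m ω]
  refine ⟨α', ?_, by exact_mod_cast h2, ω, hfr.mono fun m hm => ?_⟩
  · obtain ⟨m, hm, -⟩ := hfr.exists
    exact (birkhoffSum_div_nonneg hl hexp hp hp1 m ω).trans_lt (by exact_mod_cast hm)
  · have h3 : birkhoffSum shift (psi p) m ω / birkhoffSum shift (phi f) m ω < α' := by
      exact_mod_cast hm.1
    exact ((div_lt_iff_of_neg (hneg m hm.2)).1 h3).le

end Dynamics

section Growth

variable {d : EReal → EReal → ℝ} {s : ℕ} {f : Fin (s + 1) → ℝ → ℝ} {p : Fin (s + 1) → ℝ}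

/-! ### The test function -/

/-- The function on `EReal` which is `0` on `[-∞, a]`, `1` on `[b, ∞]` and affine on `[a, b]`. -/
noncomputable def ramp (a b : ℝ) : EReal → ℝ
  | ⊥ => 0
  | ⊤ => 1
  | (x : ℝ) => max (min ((x - a) / (b - a)) 1) 0

theorem ramp_coe (a b x : ℝ) : ramp a b x = max (min ((x - a) / (b - a)) 1) 0 := rfl

theorem ramp_of_le {a b x : ℝ} (hab : a < b) (hx : x ≤ a) : ramp a b x = 0 :=
  max_eq_right ((min_le_left _ _).trans
    (div_nonpos_of_nonpos_of_nonneg (sub_nonpos.2 hx) (sub_pos.2 hab).le))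

theorem ramp_of_ge {a b x : ℝ} (hab : a < b) (hx : b ≤ x) : ramp a b x = 1 := by
  rw [ramp_coe, min_eq_right, max_eq_left zero_le_one]
  rw [one_le_div (sub_pos.2 hab)]
  linarith

theorem ramp_mem_Icc (a b : ℝ) (x : EReal) : ramp a b x ∈ Icc (0 : ℝ) 1 := by
  induction x with
  | bot => exact ⟨le_rfl, zero_le_one⟩
  | top => exact ⟨zero_le_one, le_rfl⟩
  | coe x => exact ⟨le_max_right _ _, max_le (min_le_right _ _) zero_le_one⟩

theorem exists_lipschitz_ramp (hd : IsAdmissibleMetric d) {a b : ℝ} (hab : a < b) :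
    ∃ C : ℝ, 1 ≤ C ∧ ∀ x y, |ramp a b x - ramp a b y| ≤ C * d x y := by
  have hp : ∀ x ∈ Ioi (b : EReal), ramp a b x = 1 := fun x hx => by
    induction x with
    | bot => exact absurd hx (by simp)
    | top => rfl
    | coe x => exact ramp_of_ge hab (EReal.coe_lt_coe_iff.1 hx).le
  have hm : ∀ x ∈ Iio (a : EReal), ramp a b x = 0 := fun x hx => by
    induction x with
    | bot => rfl
    | top => exact absurd hx (by simp)
    | coe x => exact ramp_of_le hab (EReal.coe_lt_coe_iff.1 hx).le
  refine hd.exists_lipschitz_of_local (B := 1) (cp := 0) (cm := 0) (fun x y => ?_)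
    (Ioi_mem_nhds (EReal.coe_lt_top b)) (Iio_mem_nhds (EReal.bot_lt_coe a))
    (fun x hx y hy => by simp [hp x hx, hp y hy]) (fun x hx y hy => by simp [hm x hx, hm y hy])
    fun R => ?_
  · have hx := ramp_mem_Icc a b x
    have hy := ramp_mem_Icc a b y
    exact abs_sub_le_iff.2 ⟨by linarith [hx.2, hy.1], by linarith [hx.1, hy.2]⟩
  · obtain ⟨C, hC, h⟩ := hd.exists_bounds R
    have hba : 0 < b - a := sub_pos.2 hab
    refine ⟨C / (b - a), fun x y hx hy => ?_⟩
    rw [ramp_coe, ramp_coe]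
    calc _ ≤ |min ((x - a) / (b - a)) 1 - min ((y - a) / (b - a)) 1| :=
          abs_max_sub_max_le_abs _ _ _
      _ ≤ |(x - a) / (b - a) - (y - a) / (b - a)| := by
          simpa using abs_min_sub_min_le_max ((x - a) / (b - a)) 1 ((y - a) / (b - a)) 1
      _ = |x - y| / (b - a) := by
          rw [← sub_div, sub_sub_sub_cancel_right, abs_div, abs_of_pos hba]
      _ ≤ C * d x y / (b - a) := by
          gcongr
          exact (h x y hx hy).1
      _ = _ := by ring

theorem exists_holderNorm_mul_ramp_le_one (hd : IsAdmissibleMetric d) {α : ℝ} (hα1 : α ≤ 1)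
    {a b : ℝ} (hab : a < b) :
    ∃ c : ℝ, 0 < c ∧ holderNorm d α (fun x => c * ramp a b x) ≤ 1 := by
  obtain ⟨C₀, hC₀, h₀⟩ := exists_lipschitz_ramp hd hab
  obtain ⟨C, hC, h⟩ := exists_holder_of_lipschitz hd hα1 (zero_le_one.trans hC₀) h₀
  have hc : 0 < (C + 1)⁻¹ := by positivity
  refine ⟨(C + 1)⁻¹, hc, ?_⟩
  have h1 : holderConst d α (fun x => (C + 1)⁻¹ * ramp a b x) ≤
      ENNReal.ofReal ((C + 1)⁻¹ * C) := by
    refine holderConst_le hd fun x y => ?_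
    rw [← mul_sub, abs_mul, abs_of_pos hc, mul_assoc]
    exact mul_le_mul_of_nonneg_left (h x y) hc.le
  have h2 : ⨆ x, ENNReal.ofReal |(C + 1)⁻¹ * ramp a b x| ≤ ENNReal.ofReal (C + 1)⁻¹ := by
    refine iSup_le fun x => ENNReal.ofReal_le_ofReal ?_
    have hx := ramp_mem_Icc a b x
    rw [abs_of_nonneg (mul_nonneg hc.le hx.1)]
    exact mul_le_of_le_one_right hc.le hx.2
  calc _ ≤ ENNReal.ofReal ((C + 1)⁻¹ * C) + ENNReal.ofReal (C + 1)⁻¹ := add_le_add h1 h2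
    _ = ENNReal.ofReal ((C + 1)⁻¹ * C + (C + 1)⁻¹) :=
        (ENNReal.ofReal_add (by positivity) hc.le).symm
    _ = 1 := by
        rw [← mul_add_one, inv_mul_cancel₀ (by positivity), ENNReal.ofReal_one]

/-! ### Growth of the Hölder norms -/

/-- A lower bound for the Hölder constant from the increment over a cylinder interval of level `m`:
the increment is a multiple of the probability `exp (S_m ψ)` of the cylinder, and the length of the
interval is at most a multiple of `exp (S_m φ)`. -/
theorem exists_le_holderConst_iterate (hd : IsAdmissibleMetric d) (hf : IsC1HolderFamily f)
    {l : ℝ} (hl : 1 < l) (hexp : ∀ i x, l ≤ deriv (f i) x) {a b : ℝ} (hab : a < b)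
    (hends : ∀ i, f i a ≤ a ∧ b ≤ f i b)
    (hdisj : ∀ i j, i ≠ j → Disjoint (f i ⁻¹' Ioo a b) (f j ⁻¹' Ioo a b))
    (hp : ∀ i, 0 < p i) (hp1 : ∑ i, p i = 1) {α : ℝ} (hα : 0 < α) {c : ℝ} (hc : 0 < c) :
    ∃ K : ℝ, 0 < K ∧ ∀ (ω : ℕ → Fin (s + 1)) (m n : ℕ), m ≤ n →
      ENNReal.ofReal (K * Real.exp (birkhoffSum shift (psi p) m ω -
        α * birkhoffSum shift (phi f) m ω)) ≤
        holderConst d α ((transition f p)^[n] fun x => c * ramp a b x) := by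
  obtain ⟨D, hD, hdist⟩ := exists_sub_le_exp_birkhoffSum_phi hf hl hexp hab hends
  obtain ⟨C, hC, hbd⟩ := hd.exists_bounds (max |a| |b|)
  refine ⟨c / (C * D) ^ α, by positivity, fun ω m n hmn => ?_⟩
  obtain ⟨z, hz⟩ := orbit_surjective hf ω m a
  obtain ⟨y, hy⟩ := orbit_surjective hf ω m b
  have hzy : z < y := (orbit_strictMono hl hexp ω m).lt_iff_lt.1 (by rwa [hz, hy])
  have habs : ∀ x ∈ Icc a b, |x| ≤ max |a| |b| := fun x hx => abs_le_max_abs_abs hx.1 hx.2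
  have hzI : z ∈ Icc a b := mem_Icc_of_orbit_mem_Icc hl hexp hends (ω := ω) (n := m)
    (by rw [hz]; exact left_mem_Icc.2 hab.le)
  have hyI : y ∈ Icc a b := mem_Icc_of_orbit_mem_Icc hl hexp hends (ω := ω) (n := m)
    (by rw [hy]; exact right_mem_Icc.2 hab.le)
  have hne : (y : EReal) ≠ z := by exact_mod_cast hzy.ne'
  have hinc := transition_iterate_sub hf hl hexp hab hends hdisj hp hp1
    (h := fun x => c * ramp a b x) (u := 0) (v := c)
    (fun x hx => by simp [ramp_of_le hab hx]) (fun x hx => by simp [ramp_of_ge hab hx]) hmn hz hy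
  refine le_trans (ENNReal.ofReal_le_ofReal ?_) (le_holderConst d α _ hne)
  have hpos := hd.pos hne
  have hd1 : d y z ≤ C * D * Real.exp (birkhoffSum shift (phi f) m ω) := by
    calc d y z ≤ C * |y - z| := (hbd y z (habs y hyI) (habs z hzI)).2
      _ = C * (y - z) := by rw [abs_of_pos (sub_pos.2 hzy)]
      _ ≤ C * (D * Real.exp (birkhoffSum shift (phi f) m ω)) := by
          gcongr
          exact hdist m ω z y hz hy
      _ = _ := by ring
  have hd2 : d y z ^ α ≤ (C * D) ^ α * Real.exp (α * birkhoffSum shift (phi f) m ω) := by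
    calc d y z ^ α ≤ (C * D * Real.exp (birkhoffSum shift (phi f) m ω)) ^ α :=
          Real.rpow_le_rpow hpos.le hd1 hα.le
      _ = _ := by
          rw [Real.mul_rpow (by positivity) (Real.exp_pos _).le, ← Real.exp_mul, mul_comm α]
  rw [hinc, sub_zero, abs_of_pos (by positivity), le_div_iff₀ (Real.rpow_pos_of_pos hpos α)]
  calc c / (C * D) ^ α * Real.exp (birkhoffSum shift (psi p) m ω -
        α * birkhoffSum shift (phi f) m ω) * d y z ^ α
      ≤ c / (C * D) ^ α * Real.exp (birkhoffSum shift (psi p) m ω -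
        α * birkhoffSum shift (phi f) m ω) *
        ((C * D) ^ α * Real.exp (α * birkhoffSum shift (phi f) m ω)) := by gcongr
    _ = Real.exp (birkhoffSum shift (psi p) m ω) * c := by
        rw [Real.exp_sub]
        field_simp

theorem tendsto_holderNorm_iterate_mul_ramp (hd : IsAdmissibleMetric d) (hf : IsC1HolderFamily f)
    {l : ℝ} (hl : 1 < l) (hexp : ∀ i x, l ≤ deriv (f i) x) {a b : ℝ} (hab : a < b)
    (hends : ∀ i, f i a ≤ a ∧ b ≤ f i b)
    (hdisj : ∀ i j, i ≠ j → Disjoint (f i ⁻¹' Ioo a b) (f j ⁻¹' Ioo a b))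
    (hp : ∀ i, 0 < p i) (hp1 : ∑ i, p i = 1) {α : ℝ} (hα : alphaMinus f p < α)
    {c : ℝ} (hc : 0 < c) :
    Tendsto (fun n => holderNorm d α ((transition f p)^[n] fun x => c * ramp a b x))
      atTop (𝓝 ⊤) := by
  obtain ⟨α', hα', hlt, ω, hω⟩ := exists_frequently_birkhoffSum hl hexp hp hp1 hα
  obtain ⟨K, hK, hle⟩ := exists_le_holderConst_iterate hd hf hl hexp hab hends hdisj hp hp1
    (hα'.trans hlt) hc
  have hgap : 0 < (α - α') * Real.log l := mul_pos (sub_pos.2 hlt) (Real.log_pos hl)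
  have hgrow : Tendsto (fun m : ℕ => K * Real.exp ((α - α') * Real.log l * m)) atTop atTop :=
    (Real.tendsto_exp_atTop.comp
      (tendsto_natCast_atTop_atTop.const_mul_atTop hgap)).const_mul_atTop hK
  refine ENNReal.tendsto_nhds_top_iff_nnreal.2 fun N => ?_
  obtain ⟨m, hm, hN⟩ := (hω.and_eventually (hgrow.eventually_gt_atTop N)).exists
  filter_upwards [eventually_ge_atTop m] with n hn
  have hexpo : (α - α') * Real.log l * m ≤
      birkhoffSum shift (psi p) m ω - α * birkhoffSum shift (phi f) m ω := by
    have := mul_le_mul_of_nonneg_left (birkhoffSum_phi_le hl hexp m ω) (sub_nonneg.2 hlt.le)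
    linarith
  calc (N : ℝ≥0∞) = ENNReal.ofReal N := (ENNReal.ofReal_coe_nnreal).symm
    _ < ENNReal.ofReal (K * Real.exp ((α - α') * Real.log l * m)) :=
        (ENNReal.ofReal_lt_ofReal_iff (by positivity)).2 hN
    _ ≤ ENNReal.ofReal (K * Real.exp (birkhoffSum shift (psi p) m ω -
          α * birkhoffSum shift (phi f) m ω)) := by gcongr
    _ ≤ _ := hle ω m n hn
    _ ≤ _ := le_self_add

end Growth

end RealRDS

theorem corollary1p4 (s : ℕ) (hs : 1 ≤ s)
    (d : EReal → EReal → ℝ) (hd : RealRDS.IsAdmissibleMetric d)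
    (f : Fin (s + 1) → ℝ → ℝ) (hf : RealRDS.IsC1HolderFamily f)
    (hexp : RealRDS.IsExpanding f) (hfix : RealRDS.HasNoCommonFixedPoint f)
    (hcon : RealRDS.IsContractingNearInfinity d f)
    (hosc : RealRDS.OpenSetCondition f)
    (p : Fin (s + 1) → ℝ) (hp : ∀ i, 0 < p i) (hp1 : ∑ i, p i = 1)
    (hlt : RealRDS.alphaMinus f p < 1)
    (α : ℝ) (hα : RealRDS.alphaMinus f p < (α : EReal)) (hα1 : α < 1) :
    -- every iterate of the transition operator is a bounded operator on `C^α`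
    (∀ n : ℕ, (∀ h : EReal → ℝ, RealRDS.IsHolder d α h →
        RealRDS.IsHolder d α ((RealRDS.transition f p)^[n] h)) ∧
      RealRDS.holderOpNorm d α ((RealRDS.transition f p)^[n]) < ⊤) ∧
    (∃ φ : EReal → ℝ, RealRDS.IsHolder d α φ ∧
      Tendsto (fun n : ℕ => RealRDS.holderNorm d α ((RealRDS.transition f p)^[n] φ))
        atTop (𝓝 ⊤)) ∧
    Tendsto (fun n : ℕ => RealRDS.holderOpNorm d α ((RealRDS.transition f p)^[n]))
      atTop (𝓝 ⊤) := by
  obtain ⟨l, hl, hexp⟩ := hexp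
  obtain ⟨a, b, hab, hsub, hdisj⟩ := hosc
  have hends : ∀ i, f i a ≤ a ∧ b ≤ f i b := fun i =>
    RealRDS.le_left_and_right_le hab (RealRDS.strictMono_of_le_deriv hl hexp i)
      (hf.1 i).1.surjective (hsub i)
  have hα0 : 0 < α := by
    obtain ⟨α', h0, h1, -⟩ := RealRDS.exists_frequently_birkhoffSum hl hexp hp hp1 hα
    exact h0.trans h1
  obtain ⟨c, hc, hnorm⟩ := RealRDS.exists_holderNorm_mul_ramp_le_one hd hα1.le hab
  have hholder : RealRDS.IsHolder d α (fun x => c * RealRDS.ramp a b x) :=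
    (le_self_add.trans hnorm).trans_lt ENNReal.one_lt_top
  have htend := RealRDS.tendsto_holderNorm_iterate_mul_ramp hd hf hl hexp hab hends hdisj hp hp1
    hα hc
  refine ⟨fun n => ⟨fun h hh => RealRDS.isHolder_iterate_transition hd hf hcon hα0 hp hp1 n hh,
    RealRDS.holderOpNorm_iterate_transition_lt_top hd hf hcon hα0 hp hp1 n⟩,
    ⟨_, hholder, htend⟩, tendsto_nhds_top_mono' htend fun n => ?_⟩
  -- The norm of the test function is at most `1`, so it competes in the operator norm.
  exact le_iSup_of_le _ (le_iSup_of_le hholder (le_iSup_of_le hnorm le_rfl))
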